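/- Let $G$ be a finite simple connected graph with maximum degree $\Delta(G)\ge 3$, and let $n>2$ be an integer. Let $G^{1/n}$ be the $n$-subdivision of $G$, that is, the graph obtained from $G$ by replacing each edge by a path of length $n$ (with $n-1$ new internal vertices), and let $G^{2/n}=(G^{1/n})^2$ be its square, that is, the graph on the vertex set of $G^{1/n}$ in which two distinct vertices are adjacent if and only if their distance in $G^{1/n}$ is at most $2$. Then \[\chi(G^{2/n})=\Delta(G)+1=\omega(G^{2/n}),\] where $\chi$ denotes the chromatic number and $\omega$ the clique number (the maximum size of a clique). -/

import Mathlib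

namespace SimpleGraph

/-- The `k`-power of `G`: distinct vertices are joined when their distance is at most `k`.
The extended distance is used, so vertices in different components are never joined. -/
def power {V : Type*} (G : SimpleGraph V) (k : ℕ) : SimpleGraph V where
  Adj x y := x ≠ y ∧ G.edist x y ≤ (k : ℕ∞)
  symm := ⟨fun x y h => ⟨h.1.symm, by rw [SimpleGraph.edist_comm]; exact h.2⟩⟩
  loopless := ⟨fun _ h => h.1 rfl⟩

/-- Vertices of the `k`-subdivision: the terminal vertices (those of `G`), and `k - 1` internal
vertices for each edge of `G`. -/
abbrev SubdivVertex {V : Type*} (G : SimpleGraph V) (k : ℕ) : Type _ :=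
  V ⊕ (G.edgeSet × Fin (k - 1))

/-- The vertex at position `l` (for `0 ≤ l ≤ k`) on the path of length `k` that replaces the
edge `e`. The path is traversed from one endpoint of `e` to the other in an arbitrarily chosen
direction; the internal vertex at position `l` is `(e, l - 1)`. -/
noncomputable def hyperedgeVertex {V : Type*} (G : SimpleGraph V) (k : ℕ) (e : G.edgeSet)
    (l : ℕ) : G.SubdivVertex k :=
  if l = 0 then Sum.inl (Quot.out (e : Sym2 V)).1
  else if h : l - 1 < k - 1 then Sum.inr (e, ⟨l - 1, h⟩)
  else Sum.inl (Quot.out (e : Sym2 V)).2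

/-- The `k`-subdivision of `G` (for `k ≥ 1`): every edge is replaced by a path of length `k`. -/
def subdivision {V : Type*} (G : SimpleGraph V) (k : ℕ) : SimpleGraph (G.SubdivVertex k) :=
  SimpleGraph.fromRel fun x y => ∃ (e : G.edgeSet) (l : ℕ), l < k ∧
    x = G.hyperedgeVertex k e l ∧ y = G.hyperedgeVertex k e (l + 1)

/-- The fractional power `G^{m/n}`: the `m`-power of the `n`-subdivision of `G`. -/
def fracPower {V : Type*} (G : SimpleGraph V) (m n : ℕ) : SimpleGraph (G.SubdivVertex n) :=
  (G.subdivision n).power m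

end SimpleGraph

/-! A vertex of maximum degree and its neighbours in the subdivision form a clique of size Δ + 1. It
remains to colour with Δ + 1 colours. For n ≠ 5, one colour `o` is reserved for all original
vertices. The half-edges get the other Δ colours, distinct at each vertex and distinct on the two
halves of each edge (`exists_isHalfEdgeColoring`). Each path is then filled by blocks of length 3
and 4 that start and end at `o`; 5 is the only n > 2 that is not a sum of 3s and 4s. For n = 5, the
original vertices are coloured properly instead, the half-edges at v get any distinct colours other
than that of v, and the two middle vertices of each path can still be chosen
(`exists_isPathSquareColoring_five`). -/

namespace SimpleGraph

/-- A colouring of the half-edges of `G`, where `c v w` is the colour of the half of `vw` at `v`: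
half-edges at a common vertex get distinct colours, and so do the two halves of an edge. -/
structure IsHalfEdgeColoring {V C : Type*} (G : SimpleGraph V) (c : V → V → C) : Prop where
  inj : ∀ v w w', G.Adj v w → G.Adj v w' → c v w = c v w' → w = w'
  ne : ∀ v w, G.Adj v w → c v w ≠ c w v

/-! ### Half-edge colourings, and greedy vertex colouring -/

section HalfEdge

variable {V C : Type*} {G H : SimpleGraph V} {c : V → V → C}

/-- A Kempe chain argument: exchanging `a` and `b` along the chain from `u` frees `b` at `u`, and
the chain cannot reach `v`, since entering a vertex requires a half-edge coloured `a` there. -/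
theorem IsHalfEdgeColoring.swap_on [DecidableEq C] (hc : H.IsHalfEdgeColoring c) (a b : C)
    (u v : V) (huv : u ≠ v) (hu : ∀ w, H.Adj u w → c u w ≠ a) (hv : ∀ w, H.Adj v w → c v w ≠ a) :
    ∃ c' : V → V → C, H.IsHalfEdgeColoring c' ∧ (∀ w, H.Adj u w → c' u w ≠ b) ∧
      ∀ w, H.Adj v w → c' v w ≠ a := by
  classical
  let R : V → V → Prop := fun x y => H.Adj x y ∧ c x y = b ∧ c y x = a
  let S : V → Prop := Relation.ReflTransGen R u
  have hvS : ¬ S v := by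
    intro h
    rcases Relation.ReflTransGen.cases_tail h with h | ⟨x, -, hx⟩
    · exact huv h.symm
    · exact hv x hx.1.symm hx.2.2
  -- `S` is closed under `R` both ways, so no edge with halves coloured `a` and `b` leaves `S`;
  -- these are the only edges that the swap could spoil.
  have fwd : ∀ x y, S x → R x y → S y := fun x y hx hxy => hx.tail hxy
  have bwd : ∀ x y, S y → R x y → S x := by
    intro x y hy hxy
    rcases Relation.ReflTransGen.cases_tail hy with h | ⟨z, hz, hzy⟩
    · subst h
      exact absurd hxy.2.2 (hu x hxy.1.symm)
    · have : x = z := hc.inj y x z hxy.1.symm hzy.1.symm (hxy.2.2.trans hzy.2.2.symm)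
      exact this ▸ hz
  refine ⟨fun x y => if S x then Equiv.swap a b (c x y) else c x y, ⟨?_, ?_⟩, ?_, ?_⟩
  · intro x y z hy hz h
    by_cases hx : S x
    · simp only [hx, if_true] at h
      exact hc.inj x y z hy hz ((Equiv.swap a b).injective h)
    · simp only [hx, if_false] at h
      exact hc.inj x y z hy hz h
  · have key : ∀ x y, H.Adj x y → S x → ¬ S y → Equiv.swap a b (c x y) ≠ c y x := by
      intro x y hxy hx hy h
      have hne := hc.ne x y hxy
      by_cases h1 : c x y = a
      · rw [h1, Equiv.swap_apply_left] at h
        exact hy (bwd y x hx ⟨hxy.symm, h.symm, h1⟩)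
      · by_cases h2 : c x y = b
        · rw [h2, Equiv.swap_apply_right] at h
          exact hy (fwd x y hx ⟨hxy, h2, h.symm⟩)
        · rw [Equiv.swap_apply_of_ne_of_ne h1 h2] at h
          exact hne h
    intro x y hxy
    by_cases hx : S x <;> by_cases hy : S y <;> simp only [hx, hy, if_true, if_false]
    · exact fun h => hc.ne x y hxy ((Equiv.swap a b).injective h)
    · exact key x y hxy hx hy
    · exact (key y x hxy.symm hy hx).symm
    · exact hc.ne x y hxy
  · intro w hw h
    have hS : S u := Relation.ReflTransGen.refl
    simp only [hS, if_true] at h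
    rw [Equiv.swap_apply_eq_iff, Equiv.swap_apply_right] at h
    exact hu w hw h
  · intro w hw
    simp only [hvS, if_false]
    exact hv w hw

theorem IsHalfEdgeColoring.insert_edge {u v : V}
    (hc : (G.deleteEdges {s(u, v)}).IsHalfEdgeColoring c) {a b : C} (hab : a ≠ b) (huv : u ≠ v)
    (hu : ∀ w, (G.deleteEdges {s(u, v)}).Adj u w → c u w ≠ a)
    (hv : ∀ w, (G.deleteEdges {s(u, v)}).Adj v w → c v w ≠ b) :
    ∃ c' : V → V → C, G.IsHalfEdgeColoring c' := by
  classical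
  have hinj := hc.inj
  have hne := hc.ne
  simp only [deleteEdges_adj, Set.mem_singleton_iff, Sym2.eq_iff, not_or, not_and] at hinj hne hu hv
  refine ⟨fun x y => if x = u ∧ y = v then a else if x = v ∧ y = u then b else c x y, ?_, ?_⟩
  · intro x y z hy hz h
    grind
  · intro x y hxy
    grind

theorem exists_missing_color [Finite V] [Fintype C] {u v : V} (huv : G.Adj u v)
    (hdeg : (G.neighborSet u).ncard ≤ Fintype.card C) (f : V → C) :
    ∃ a, ∀ w, (G.deleteEdges {s(u, v)}).Adj u w → f w ≠ a := by
  by_contra! h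
  have h1 : (Set.univ : Set C) ⊆ f '' (G.neighborSet u \ {v}) := by
    intro a _
    obtain ⟨w, hw, rfl⟩ := h a
    rw [deleteEdges_adj] at hw
    refine ⟨w, ⟨hw.1, ?_⟩, rfl⟩
    rintro rfl
    exact hw.2 rfl
  have h2 := Set.ncard_le_ncard h1 (Set.toFinite _)
  have h3 := Set.ncard_image_le (f := f) (Set.toFinite (G.neighborSet u \ {v}))
  have h4 := Set.ncard_sdiff_singleton_add_one (s := G.neighborSet u) (a := v) huv (Set.toFinite _)
  rw [Set.ncard_univ, Nat.card_eq_fintype_card] at h2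
  omega

/-- Induction on edges: with `uv` deleted, some colour is free at each end. If the chosen free
colours coincide, `swap_on` makes them differ. -/
theorem exists_isHalfEdgeColoring [Finite V] [Fintype C] [Nontrivial C] (G : SimpleGraph V)
    (hdeg : ∀ v, (G.neighborSet v).ncard ≤ Fintype.card C) :
    ∃ c : V → V → C, G.IsHalfEdgeColoring c := by
  classical
  induction G using WellFoundedLT.induction with
  | ind G ih =>
  by_cases hG : ∃ u v, G.Adj u v
  · obtain ⟨u, v, huv⟩ := hG
    have hle : G.deleteEdges {s(u, v)} ≤ G := G.deleteEdges_le _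
    have hlt : G.deleteEdges {s(u, v)} < G := by
      refine lt_of_le_of_ne hle fun h => ?_
      rw [← h, deleteEdges_adj] at huv
      exact huv.2 rfl
    obtain ⟨c, hc⟩ := ih _ hlt fun x =>
      (Set.ncard_le_ncard (fun y hy => hle hy) (Set.toFinite _)).trans (hdeg x)
    obtain ⟨a, ha⟩ := exists_missing_color huv (hdeg u) (c u)
    obtain ⟨b, hb⟩ := exists_missing_color huv.symm (hdeg v) (c v)
    rw [Sym2.eq_swap] at hb
    by_cases hab : a = b
    · subst hab
      obtain ⟨b, hba⟩ := exists_ne a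
      obtain ⟨c', hc', hu, hv⟩ := hc.swap_on a b u v huv.ne ha hb
      exact hc'.insert_edge hba huv.ne hu hv
    · exact hc.insert_edge hab huv.ne ha hb
  · push Not at hG
    exact ⟨fun _ _ => Classical.arbitrary C, fun v w _ h => absurd h (hG v w),
      fun v w h => absurd h (hG v w)⟩

theorem exists_coloring_of_ncard_neighborSet_lt [Finite V] [Fintype C] (G : SimpleGraph V)
    (hdeg : ∀ v, (G.neighborSet v).ncard < Fintype.card C) :
    ∃ c : V → C, ∀ v w, G.Adj v w → c v ≠ c w := by
  classical
  have := Fintype.ofFinite V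
  rcases isEmpty_or_nonempty V with hV | ⟨⟨x⟩⟩
  · exact ⟨hV.elim, hV.elim⟩
  have : Nonempty C := Fintype.card_pos_iff.1 (by have := hdeg x; omega)
  suffices ∀ s : Finset V, ∃ c : V → C, ∀ v ∈ s, ∀ w ∈ s, G.Adj v w → c v ≠ c w by
    obtain ⟨c, hc⟩ := this Finset.univ
    exact ⟨c, fun v w => hc v (Finset.mem_univ _) w (Finset.mem_univ _)⟩
  intro s
  induction s using Finset.induction_on with
  | empty => exact ⟨fun _ => Classical.arbitrary C, by simp⟩
  | insert u s hu ih =>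
    obtain ⟨c, hc⟩ := ih
    obtain ⟨a, ha⟩ : ∃ a, a ∉ c '' G.neighborSet u := by
      by_contra! h
      have h1 := Set.ncard_image_le (f := c) (Set.toFinite (G.neighborSet u))
      rw [Set.eq_univ_of_forall h, Set.ncard_univ, Nat.card_eq_fintype_card] at h1
      have := hdeg u
      omega
    have ha' : ∀ w, G.Adj u w → c w ≠ a := fun w hw h => ha ⟨w, hw, h⟩
    refine ⟨Function.update c u a, fun v hv w hw hvw => ?_⟩
    have := hvw.ne
    have := hvw.symm
    simp only [Finset.mem_insert, Function.update_apply] at *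
    grind

end HalfEdge

/-! ### Extending colours along a path -/

/-- A colouring `p` of the path `0, …, n` in which vertices at distance at most two get distinct
colours. -/
structure IsPathSquareColoring {C : Type*} (n : ℕ) (p : ℕ → C) : Prop where
  ne_succ : ∀ i, i < n → p i ≠ p (i + 1)
  ne_add_two : ∀ i, i + 1 < n → p i ≠ p (i + 2)

section Path

variable {C : Type*}

theorem exists_ne_and_ne_and_ne [Fintype C] (hC : 4 ≤ Fintype.card C) (x y z : C) :
    ∃ t, t ≠ x ∧ t ≠ y ∧ t ≠ z := by
  classical
  obtain ⟨t, ht⟩ : ∃ t, t ∉ ({x, y, z} : Finset C) := by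
    by_contra! h
    have := Finset.card_le_three (a := x) (b := y) (c := z)
    rw [Finset.eq_univ_of_forall h, Finset.card_univ] at this
    omega
  simp only [Finset.mem_insert, Finset.mem_singleton, not_or] at ht
  exact ⟨t, ht⟩

theorem exists_isPathSquareColoring_closed [Fintype C] (hC : 4 ≤ Fintype.card C) {o a b : C}
    (ha : a ≠ o) (hb : b ≠ o) (hab : a ≠ b) (n : ℕ) (hn : 2 < n) (h5 : n ≠ 5) :
    ∃ p : ℕ → C, IsPathSquareColoring n p ∧ p 0 = o ∧ p 1 = a ∧ p (n - 1) = b ∧ p n = o := by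
  obtain ⟨t, hto, hta, htb⟩ := exists_ne_and_ne_and_ne hC o a b
  induction n using Nat.strong_induction_on with
  | _ n ih =>
  by_cases h3 : n = 3
  · subst h3
    refine ⟨fun i => if i = 1 then a else if i = 2 then b else o, ⟨?_, ?_⟩, ?_⟩ <;> grind
  by_cases h4 : n = 4
  · subst h4
    refine ⟨fun i => if i = 1 then a else if i = 2 then t else if i = 3 then b else o,
      ⟨?_, ?_⟩, ?_⟩ <;> grind
  -- Removing a block of length 3 from 8 would leave the excluded length 5, so two blocks of length
  -- 4 are used.
  by_cases h8 : n = 8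
  · subst h8
    refine ⟨fun i => if i % 4 = 1 then a else if i % 4 = 2 then t else if i % 4 = 3 then b else o,
      ⟨?_, ?_⟩, ?_⟩ <;> grind
  obtain ⟨p, hp, h0, h1, hl, hr⟩ := ih (n - 3) (by omega) (by omega) (by omega)
  -- Prepend the block `o, a, b`; since `p` begins with `o, a`, the junction is legal.
  refine ⟨fun i => if i = 0 then o else if i = 1 then a else if i = 2 then b else p (i - 3),
    ⟨?_, ?_⟩, ?_⟩
  · intro i hi
    match i with
    | 0 => simpa using ha.symm
    | 1 => simpa using hab
    | 2 => simpa [h0] using hb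
    | i + 3 => simpa using hp.ne_succ i (by omega)
  · intro i hi
    match i with
    | 0 => simpa using hb.symm
    | 1 => simpa [h0] using ha
    | 2 => simpa [h1] using hab.symm
    | i + 3 => simpa using hp.ne_add_two i (by omega)
  · have e1 : n - 1 - 3 = n - 3 - 1 := by omega
    have e2 : ¬ n = 0 ∧ ¬ n = 1 ∧ ¬ n = 2 ∧ ¬ n - 1 = 0 ∧ ¬ n - 1 = 1 ∧ ¬ n - 1 = 2 := by omega
    simp [e1, e2, hl, hr]

/-- The path is coloured `x, a, s, t, b, y`. Here `a` and `b` are at distance 3 and may coincide, so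
the halves of an edge need no coordination. -/
theorem exists_isPathSquareColoring_five [Fintype C] (hC : 4 ≤ Fintype.card C) {x a b y : C}
    (ha : a ≠ x) (hb : b ≠ y) (hxy : x ≠ y) :
    ∃ p : ℕ → C, IsPathSquareColoring 5 p ∧ p 0 = x ∧ p 1 = a ∧ p 4 = b ∧ p 5 = y := by
  obtain ⟨s, t, hs1, hs2, hs3, ht1, ht2, ht3, hst⟩ : ∃ s t, s ≠ x ∧ s ≠ a ∧ s ≠ b ∧
      t ≠ a ∧ t ≠ b ∧ t ≠ y ∧ s ≠ t := by
    obtain ⟨s, hs⟩ := exists_ne_and_ne_and_ne hC x a b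
    obtain ⟨t, ht⟩ := exists_ne_and_ne_and_ne hC a b y
    obtain ⟨s', hs'⟩ := exists_ne_and_ne_and_ne hC a b s
    by_cases hst : s = t
    · by_cases hx : s' = x
      · exact ⟨s, s', by grind⟩
      · exact ⟨s', t, by grind⟩
    · exact ⟨s, t, by grind⟩
  refine ⟨fun i => if i = 0 then x else if i = 1 then a else if i = 2 then s else
    if i = 3 then t else if i = 4 then b else y, ⟨?_, ?_⟩, ?_⟩ <;> grind

end Path

/-! ### Adjacency in the subdivision, the clique and the colouring -/

section Subdivision

variable {V : Type*} {G : SimpleGraph V} {n : ℕ}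

theorem power_two_adj_iff {W : Type*} (H : SimpleGraph W) (x y : W) :
    (H.power 2).Adj x y ↔ x ≠ y ∧ (H.Adj x y ∨ ∃ z, H.Adj z x ∧ H.Adj z y) := by
  refine and_congr_right fun hne => ⟨fun h => ?_, ?_⟩
  · have htop : H.edist x y ≠ ⊤ := ne_top_of_le_ne_top (ENat.natCast_ne_top 2) h
    obtain ⟨p, hp⟩ := exists_walk_of_edist_ne_top htop
    rw [← hp] at h
    have hlen : p.length ≤ 2 := by exact_mod_cast h
    match p, hlen with
    | .nil, _ => exact absurd rfl hne
    | .cons h .nil, _ => exact Or.inl h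
    | .cons h (.cons h' .nil), _ => exact Or.inr ⟨_, h.symm, h'⟩
    | .cons _ (.cons _ (.cons _ _)), hlen => simp at hlen
  · rintro (h | ⟨z, hx, hy⟩)
    · exact (edist_le h.toWalk).trans (by simp)
    · exact (edist_le (Walk.cons hx.symm hy.toWalk)).trans (by simp)

theorem mk_out_edge (e : G.edgeSet) :
    s((Quot.out (e : Sym2 V)).1, (Quot.out (e : Sym2 V)).2) = (e : Sym2 V) :=
  Quot.out_eq (e : Sym2 V)

theorem adj_out_edge (e : G.edgeSet) :
    G.Adj (Quot.out (e : Sym2 V)).1 (Quot.out (e : Sym2 V)).2 := by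
  rw [← mem_edgeSet, mk_out_edge]
  exact e.2

theorem hyperedgeVertex_eq_inr_iff (e e' : G.edgeSet) (l : ℕ) (i : Fin (n - 1)) :
    G.hyperedgeVertex n e l = Sum.inr (e', i) ↔ e = e' ∧ l = i + 1 := by
  have := i.2
  unfold hyperedgeVertex
  split_ifs with h1 h2
  · simp [h1]
  · simp only [Sum.inr.injEq, Prod.mk.injEq, Fin.ext_iff]
    refine and_congr_right fun _ => ?_
    omega
  · simp only [false_iff, not_and]
    omega

theorem hyperedgeVertex_of_pos_of_lt (e : G.edgeSet) {l : ℕ} (h0 : 0 < l) (hl : l < n) :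
    G.hyperedgeVertex n e l = Sum.inr (e, ⟨l - 1, by omega⟩) :=
  (hyperedgeVertex_eq_inr_iff e e _ _).2 ⟨rfl, by simp only; omega⟩

theorem hyperedgeVertex_zero (e : G.edgeSet) :
    G.hyperedgeVertex n e 0 = Sum.inl (Quot.out (e : Sym2 V)).1 := rfl

theorem hyperedgeVertex_self (hn : 0 < n) (e : G.edgeSet) :
    G.hyperedgeVertex n e n = Sum.inl (Quot.out (e : Sym2 V)).2 := by
  simp [hyperedgeVertex, hn.ne']

theorem hyperedgeVertex_eq_inl (e : G.edgeSet) {l : ℕ} (hl : l ≤ n) (hn : 0 < n) {v : V}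
    (h : G.hyperedgeVertex n e l = Sum.inl v) :
    (l = 0 ∧ (Quot.out (e : Sym2 V)).1 = v) ∨ (l = n ∧ (Quot.out (e : Sym2 V)).2 = v) := by
  rcases Nat.eq_zero_or_pos l with rfl | h0
  · exact Or.inl ⟨rfl, Sum.inl_injective h⟩
  rcases hl.eq_or_lt with rfl | hl
  · rw [hyperedgeVertex_self hn] at h
    exact Or.inr ⟨rfl, Sum.inl_injective h⟩
  · rw [hyperedgeVertex_of_pos_of_lt e h0 hl] at h
    cases h

theorem subdivision_adj_hyperedgeVertex (hn : 1 < n) (e : G.edgeSet) {l : ℕ} (hl : l < n) :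
    (G.subdivision n).Adj (G.hyperedgeVertex n e l) (G.hyperedgeVertex n e (l + 1)) := by
  refine (fromRel_adj _ _ _).2 ⟨fun h => ?_, Or.inl ⟨e, l, hl, rfl, rfl⟩⟩
  rcases Nat.eq_zero_or_pos l with rfl | h0
  · rw [hyperedgeVertex_of_pos_of_lt (n := n) e (l := 0 + 1) (by omega) (by omega)] at h
    cases h
  · rw [hyperedgeVertex_of_pos_of_lt e h0 hl] at h
    have := ((hyperedgeVertex_eq_inr_iff _ _ _ _).1 h.symm).2
    simp only at this
    omega

theorem exists_hyperedgeVertex_of_subdivision_adj {x y : G.SubdivVertex n}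
    (h : (G.subdivision n).Adj x y) : ∃ (e : G.edgeSet) (l : ℕ), l < n ∧
      ((x = G.hyperedgeVertex n e l ∧ y = G.hyperedgeVertex n e (l + 1)) ∨
        (y = G.hyperedgeVertex n e l ∧ x = G.hyperedgeVertex n e (l + 1))) := by
  rcases ((fromRel_adj _ _ _).1 h).2 with ⟨e, l, hl, h⟩ | ⟨e, l, hl, h⟩
  · exact ⟨e, l, hl, Or.inl h⟩
  · exact ⟨e, l, hl, Or.inr h⟩

/-- `x` is the first internal vertex met on the path replacing the edge `vw`, starting at `v`. -/
def IsHalfEdgeVertex (G : SimpleGraph V) (n : ℕ) (v w : V) (x : G.SubdivVertex n) : Prop :=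
  ∃ e : G.edgeSet, (Quot.out (e : Sym2 V) = (v, w) ∧ x = G.hyperedgeVertex n e 1) ∨
    (Quot.out (e : Sym2 V) = (w, v) ∧ x = G.hyperedgeVertex n e (n - 1))

theorem IsHalfEdgeVertex.adj {v w : V} {x : G.SubdivVertex n} (h : G.IsHalfEdgeVertex n v w x) :
    G.Adj v w := by
  obtain ⟨e, ⟨h, -⟩ | ⟨h, -⟩⟩ := h
  · simpa [h] using adj_out_edge e
  · simpa [h] using (adj_out_edge e).symm

theorem IsHalfEdgeVertex.exists_eq_inr (hn : 2 < n) {v w : V} {x : G.SubdivVertex n}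
    (h : G.IsHalfEdgeVertex n v w x) :
    ∃ (e : G.edgeSet) (i : Fin (n - 1)), (e : Sym2 V) = s(v, w) ∧ x = Sum.inr (e, i) := by
  obtain ⟨e, ⟨h, rfl⟩ | ⟨h, rfl⟩⟩ := h
  · refine ⟨e, _, ?_, hyperedgeVertex_of_pos_of_lt e (by omega) (by omega)⟩
    rw [← mk_out_edge e, h]
  · refine ⟨e, _, ?_, hyperedgeVertex_of_pos_of_lt e (by omega) (by omega)⟩
    rw [← mk_out_edge e, h, Sym2.eq_swap]

theorem exists_isHalfEdgeVertex {v w : V} (h : G.Adj v w) :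
    ∃ x, G.IsHalfEdgeVertex n v w x := by
  have := mk_out_edge (⟨s(v, w), h⟩ : G.edgeSet)
  rcases Sym2.eq_iff.1 this with h' | h'
  · exact ⟨_, ⟨s(v, w), h⟩, Or.inl ⟨Prod.ext h'.1 h'.2, rfl⟩⟩
  · exact ⟨_, ⟨s(v, w), h⟩, Or.inr ⟨Prod.ext h'.1 h'.2, rfl⟩⟩

theorem IsHalfEdgeVertex.unique {v w : V} {x y : G.SubdivVertex n}
    (hx : G.IsHalfEdgeVertex n v w x) (hy : G.IsHalfEdgeVertex n v w y) : x = y := by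
  have hne := hx.adj.ne
  obtain ⟨e, he⟩ := hx
  obtain ⟨e', he'⟩ := hy
  have h1 : (e : Sym2 V) = s(v, w) := by
    rw [← mk_out_edge e]
    rcases he with he | he <;> simp [he.1, Sym2.eq_swap]
  have h2 : (e' : Sym2 V) = s(v, w) := by
    rw [← mk_out_edge e']
    rcases he' with he | he <;> simp [he.1, Sym2.eq_swap]
  obtain rfl : e = e' := Subtype.ext (h1.trans h2.symm)
  rcases he with ⟨h, rfl⟩ | ⟨h, rfl⟩ <;> rcases he' with ⟨h', rfl⟩ | ⟨h', rfl⟩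
  · rfl
  · exact absurd (congrArg Prod.fst (h.symm.trans h')) hne
  · exact absurd (congrArg Prod.snd (h.symm.trans h')) hne
  · rfl

theorem subdivision_adj_inl_iff (hn : 2 < n) (v : V) (x : G.SubdivVertex n) :
    (G.subdivision n).Adj (Sum.inl v) x ↔ ∃ w, G.IsHalfEdgeVertex n v w x := by
  constructor
  · intro h
    obtain ⟨e, l, hl, ⟨h1, h2⟩ | ⟨h1, h2⟩⟩ := exists_hyperedgeVertex_of_subdivision_adj h
    · rcases hyperedgeVertex_eq_inl e (by omega) (by omega) h1.symm with ⟨rfl, rfl⟩ | ⟨rfl, -⟩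
      · exact ⟨_, e, Or.inl ⟨rfl, h2⟩⟩
      · omega
    · rcases hyperedgeVertex_eq_inl e (by omega) (by omega) h2.symm with ⟨h, -⟩ | ⟨hl, rfl⟩
      · omega
      · obtain rfl : l = n - 1 := by omega
        exact ⟨_, e, Or.inr ⟨rfl, h1⟩⟩
  · rintro ⟨w, e, ⟨h, rfl⟩ | ⟨h, rfl⟩⟩
    · have := subdivision_adj_hyperedgeVertex (n := n) (by omega) e (l := 0) (by omega)
      rwa [hyperedgeVertex_zero, h] at this
    · have := subdivision_adj_hyperedgeVertex (n := n) (by omega) e (l := n - 1) (by omega)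
      rw [Nat.sub_add_cancel (by omega), hyperedgeVertex_self (by omega), h] at this
      exact this.symm

theorem subdivision_adj_inr {e : G.edgeSet} {i : Fin (n - 1)}
    {x : G.SubdivVertex n} (h : (G.subdivision n).Adj (Sum.inr (e, i)) x) :
    x = G.hyperedgeVertex n e i ∨ x = G.hyperedgeVertex n e (i + 2) := by
  obtain ⟨e', l, -, ⟨h1, rfl⟩ | ⟨rfl, h2⟩⟩ := exists_hyperedgeVertex_of_subdivision_adj h
  · obtain ⟨rfl, rfl⟩ := (hyperedgeVertex_eq_inr_iff _ _ _ _).1 h1.symm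
    exact Or.inr rfl
  · obtain ⟨rfl, h⟩ := (hyperedgeVertex_eq_inr_iff _ _ _ _).1 h2.symm
    obtain rfl : l = i := by omega
    exact Or.inl rfl

/-- Colours of the original vertices and of the half-edges that can be completed along every edge
of `G` give a colouring of `G^{2/n}`. -/
theorem nonempty_coloring_fracPower_two {C : Type*} (hn : 2 < n) (c : V → C) (h : V → V → C)
    (hinj : ∀ v w w', G.Adj v w → G.Adj v w' → h v w = h v w' → w = w')
    (hpath : ∀ v w, G.Adj v w → ∃ p : ℕ → C, IsPathSquareColoring n p ∧ p 0 = c v ∧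
      p 1 = h v w ∧ p (n - 1) = h w v ∧ p n = c w) :
    Nonempty ((G.fracPower 2 n).Coloring C) := by
  choose p hp h0 h1 hl hr using fun e : G.edgeSet => hpath _ _ (adj_out_edge e)
  let col : G.SubdivVertex n → C := Sum.elim c fun x => p x.1 (x.2 + 1)
  have hcol : ∀ (e : G.edgeSet) (l : ℕ), l ≤ n → col (G.hyperedgeVertex n e l) = p e l := by
    intro e l hle
    rcases Nat.eq_zero_or_pos l with rfl | hpos
    · rw [hyperedgeVertex_zero, h0]
      rfl
    rcases hle.eq_or_lt with rfl | hlt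
    · rw [hyperedgeVertex_self hpos, hr]
      rfl
    · rw [hyperedgeVertex_of_pos_of_lt e hpos hlt]
      change p e (l - 1 + 1) = p e l
      rw [Nat.sub_add_cancel hpos]
  have hhalf : ∀ v w x, G.IsHalfEdgeVertex n v w x → col x = h v w := by
    rintro v w x ⟨e, ⟨he, rfl⟩ | ⟨he, rfl⟩⟩
    · rw [hcol e 1 (by omega), h1, he]
    · rw [hcol e (n - 1) (by omega), hl, he]
  refine ⟨Coloring.mk col fun {x y} hxy => ?_⟩
  obtain ⟨hne, hadj | ⟨z, hzx, hzy⟩⟩ := (power_two_adj_iff _ _ _).1 hxy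
  · obtain ⟨e, l, hlt, ⟨rfl, rfl⟩ | ⟨rfl, rfl⟩⟩ := exists_hyperedgeVertex_of_subdivision_adj hadj
    · rw [hcol _ _ hlt.le, hcol _ _ hlt]
      exact (hp e).ne_succ l hlt
    · rw [hcol _ _ hlt.le, hcol _ _ hlt]
      exact ((hp e).ne_succ l hlt).symm
  -- A common neighbour that is an original vertex is handled by injectivity of the half-edge
  -- colours; an internal one forces both vertices onto a single path.
  · rcases z with v | ⟨e, i⟩
    · obtain ⟨w, hw⟩ := (subdivision_adj_inl_iff hn v x).1 hzx
      obtain ⟨w', hw'⟩ := (subdivision_adj_inl_iff hn v y).1 hzy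
      intro heq
      rw [hhalf _ _ _ hw, hhalf _ _ _ hw'] at heq
      obtain rfl := hinj v w w' hw.adj hw'.adj heq
      exact hne (hw.unique hw')
    · have hi := i.2
      have hpi := (hp e).ne_add_two i (by omega)
      rcases subdivision_adj_inr hzx with rfl | rfl <;>
        rcases subdivision_adj_inr hzy with rfl | rfl
      · exact absurd rfl hne
      · rw [hcol _ _ (by omega), hcol _ _ (by omega)]
        exact hpi
      · rw [hcol _ _ (by omega), hcol _ _ (by omega)]
        exact hpi.symm
      · exact absurd rfl hne

theorem exists_isClique_fracPower_two [Fintype V] [DecidableRel G.Adj] (hn : 2 < n) (v : V) :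
    ∃ s : Finset (G.SubdivVertex n), (G.fracPower 2 n).IsClique s ∧ s.card = G.degree v + 1 := by
  classical
  choose f hf using fun w : G.neighborSet v => exists_isHalfEdgeVertex (n := n) w.2
  have hadj : ∀ w, (G.subdivision n).Adj (Sum.inl v) (f w) := fun w =>
    (subdivision_adj_inl_iff hn v _).2 ⟨w, hf w⟩
  have hinj : Function.Injective f := by
    intro w w' hww
    obtain ⟨e, i, he, hx⟩ := (hf w).exists_eq_inr hn
    obtain ⟨e', i', he', hx'⟩ := (hf w').exists_eq_inr hn
    rw [hx, hx', Sum.inr.injEq, Prod.mk.injEq] at hww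
    have := he.symm.trans ((congrArg Subtype.val hww.1).trans he')
    exact Subtype.ext (Sym2.congr_right.1 this)
  refine ⟨insert (Sum.inl v) (Finset.univ.image f), ?_, ?_⟩
  · rw [Finset.coe_insert, Finset.coe_image, Finset.coe_univ, Set.image_univ, isClique_insert]
    refine ⟨?_, ?_⟩
    · rintro _ ⟨w, rfl⟩ _ ⟨w', rfl⟩ hne
      exact (power_two_adj_iff _ _ _).2 ⟨hne, Or.inr ⟨_, hadj w, hadj w'⟩⟩
    · rintro _ ⟨w, rfl⟩ hne
      exact (power_two_adj_iff _ _ _).2 ⟨hne, Or.inl (hadj w)⟩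
  · rw [Finset.card_insert_of_notMem, Finset.card_image_of_injective _ hinj, Finset.card_univ,
      card_neighborSet_eq_degree]
    simp only [Finset.mem_image, Finset.mem_univ, true_and, not_exists]
    exact fun w h => (hadj w).ne h.symm

theorem exists_injOn_neighborSet_ne {C : Type*} [Finite V] [Fintype C] (G : SimpleGraph V) (v : V)
    (o : C) (hdeg : (G.neighborSet v).ncard < Fintype.card C) :
    ∃ f : V → C, (∀ w, G.Adj v w → f w ≠ o) ∧
      ∀ w w', G.Adj v w → G.Adj v w' → f w = f w' → w = w' := by
  classical
  have := Fintype.ofFinite V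
  have hcard : Fintype.card (G.neighborSet v) ≤ Fintype.card {x : C // x ≠ o} := by
    rw [← Nat.card_eq_fintype_card, Nat.card_coe_set_eq, Fintype.card_subtype_compl,
      Fintype.card_subtype_eq]
    omega
  obtain ⟨g⟩ := Function.Embedding.nonempty_of_card_le hcard
  refine ⟨fun w => if h : G.Adj v w then g ⟨w, h⟩ else o, fun w hw => ?_, fun w w' hw hw' h => ?_⟩
  · simp only [hw, dif_pos]
    exact (g ⟨w, hw⟩).2
  · simp only [hw, hw', dif_pos] at h
    exact congrArg Subtype.val (g.injective (Subtype.ext h))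

theorem colorable_fracPower_two [Fintype V] [DecidableRel G.Adj] (hΔ : 3 ≤ G.maxDegree)
    (hn : 2 < n) : (G.fracPower 2 n).Colorable (G.maxDegree + 1) := by
  have hdeg : ∀ v, (G.neighborSet v).ncard ≤ G.maxDegree := fun v => by
    rw [← Nat.card_coe_set_eq, Nat.card_eq_fintype_card, card_neighborSet_eq_degree]
    exact G.degree_le_maxDegree v
  have hcard : Fintype.card (Option (Fin G.maxDegree)) = G.maxDegree + 1 := by simp
  suffices h : Nonempty ((G.fracPower 2 n).Coloring (Option (Fin G.maxDegree))) by
    obtain ⟨col⟩ := h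
    exact hcard ▸ col.colorable
  by_cases h5 : n = 5
  · subst h5
    obtain ⟨c, hc⟩ := exists_coloring_of_ncard_neighborSet_lt (C := Option (Fin G.maxDegree)) G
      fun v => by rw [hcard]; exact Nat.lt_succ_of_le (hdeg v)
    choose h hne hinj using fun v => exists_injOn_neighborSet_ne G v (c v)
      (by rw [hcard]; exact Nat.lt_succ_of_le (hdeg v))
    exact nonempty_coloring_fracPower_two hn c h hinj fun v w hvw =>
      exists_isPathSquareColoring_five (by omega) (hne v w hvw) (hne w v hvw.symm) (hc v w hvw)
  · have : Nontrivial (Fin G.maxDegree) := Fin.nontrivial_iff_two_le.2 (by omega)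
    obtain ⟨h, hh⟩ := exists_isHalfEdgeColoring (C := Fin G.maxDegree) G (by simpa using hdeg)
    -- `none` is the colour reserved for the original vertices.
    refine nonempty_coloring_fracPower_two hn (fun _ => none) (fun v w => some (h v w))
      (fun v w w' hw hw' heq => hh.inj v w w' hw hw' (Option.some_injective _ heq))
      fun v w hvw => exists_isPathSquareColoring_closed (by omega) (by simp) (by simp)
        (fun heq => hh.ne v w hvw (Option.some_injective _ heq)) n hn h5

end Subdivision

end SimpleGraph

theorem theorem3 {V : Type*} [Fintype V] (G : SimpleGraph V) [DecidableRel G.Adj]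
    (hG : G.Connected) (hΔ : 3 ≤ G.maxDegree) (n : ℕ) (hn : 2 < n) :
    (G.fracPower 2 n).chromaticNumber = ((G.maxDegree + 1 : ℕ) : ℕ∞) ∧
      (G.fracPower 2 n).cliqueNum = G.maxDegree + 1 := by
  have := hG.nonempty
  obtain ⟨v, hv⟩ := G.exists_maximal_degree_vertex
  obtain ⟨s, hs, hcard⟩ := SimpleGraph.exists_isClique_fracPower_two (G := G) hn v
  rw [← hv] at hcard
  have hcol := SimpleGraph.colorable_fracPower_two hΔ hn
  refine ⟨le_antisymm hcol.chromaticNumber_le ?_, le_antisymm ?_ ?_⟩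
  · rw [← hcard]
    exact hs.card_le_chromaticNumber
  · exact_mod_cast SimpleGraph.cliqueNum_le_chromaticNumber.trans hcol.chromaticNumber_le
  · rw [← hcard]
    exact SimpleGraph.IsClique.card_le_cliqueNum (tc := hs)
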